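/- Consider LT codes with $k$ information symbols: each output symbol independently draws a degree $d\in\{1,\dots,k\}$ from a distribution with generating function $P^{(k)}(x)=\sum_{i=1}^k p^{(k)}_i x^i$ and is attached to a uniformly random set of $d$ information symbols. Assume $p^{(k)}_i\to p_i$ as $k\to\infty$ for every $i$, and let $P(x)=\sum_{i\ge 1}p_ix^i$. Belief-propagation decoding starts with all information symbols unrecovered; the ripple is the set of collected output symbols having exactly one unrecovered neighbour. In each step a uniformly random element of the ripple is chosen and its unrecovered neighbour is recovered; decoding halts when the ripple is empty. For $w\ge 0$ and $u\in(0,1]$ let $r^{(k)}_w(u)$ be $\frac1k$ times the expected size of the ripple at the stage where $\lfloor uk\rfloor$ information symbols are unrecovered, when $\lfloor wk\rfloor$ output symbols have been collected; the expectation is conditional on decoding reaching that stage. Let the number of collected output symbols be $\lfloor W k\rfloor$, where $W\ge 0$ is a random variable, independent of the code, with finite mean $\omega$, and let $u\in(0,1]$. Assume that for almost every value $w$ of $W$ decoding from $\lfloor wk\rfloor$ output symbols reaches the stage with $\lfloor uk\rfloor$ unrecovered symbols with probability bounded away from $0$ as $k\to\infty$. Then the normalized expected ripple size $\mathbb E\bigl[r^{(k)}_W(u)\bigr]$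 (the mean over $W$; it is finite for every $k$) converges, and $$r_W(u):=\lim_{k\to\infty}\mathbb E\bigl[r^{(k)}_W(u)\bigr]=u\bigl(\omega P'(1-u)+\ln u\bigr).$$ -/

import Mathlib

open MeasureTheory Filter Topology
open scoped ENNReal

noncomputable section

namespace LTCode

/-- The set of neighbours (among `k` information symbols) of one LT output symbol: draw a degree
`d` from the degree distribution `D`, then a uniformly random `d`-element subset.  (The second
branch is never used when `D` is supported on `{1, …, k}`.) -/
def symbolLaw (D : PMF ℕ) (k : ℕ) : PMF (Finset (Fin k)) :=
  D.bind fun d =>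
    if h : ((Finset.univ : Finset (Fin k)).powersetCard d).Nonempty then
      PMF.uniformOfFinset _ h
    else PMF.pure ∅

/-- The law of `n` independent random elements, each with law `q`. -/
def iidLaw {α : Type} [Fintype α] (q : PMF α) (n : ℕ) : PMF (Fin n → α) :=
  PMF.ofFintype (fun N => ∏ i, q (N i)) <| by
    classical
    have h1 : ∑ a, q a = 1 := by rw [← tsum_fintype (L := .unconditional _)]; exact q.tsum_coe
    rw [← Fintype.prod_sum (fun (_ : Fin n) a => q a)]
    simp [h1]

/-- The ripple: the received output symbols with exactly one neighbour in the set `U` of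
unrecovered information symbols. -/
def ripple {k n : ℕ} (N : Fin n → Finset (Fin k)) (U : Finset (Fin k)) : Finset (Fin n) :=
  Finset.univ.filter fun i => (N i ∩ U).card = 1

/-- One step of the decoder: pick a uniformly random output symbol in the ripple and recover its
unique unrecovered neighbour; halt (stay put) if the ripple is empty. -/
def step {k n : ℕ} (N : Fin n → Finset (Fin k)) (U : Finset (Fin k)) : PMF (Finset (Fin k)) :=
  if h : (ripple N U).Nonempty then
    (PMF.uniformOfFinset (ripple N U) h).map fun i => U \ N i
  else PMF.pure U

/-- The law of the set of unrecovered information symbols after `t` decoding steps. -/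
def decode {k n : ℕ} (N : Fin n → Finset (Fin k)) : ℕ → PMF (Finset (Fin k))
  | 0 => PMF.pure Finset.univ
  | t + 1 => (decode N t).bind (step N)

/-- The joint law of the `n` received output symbols and of the set of unrecovered information
symbols after `t` decoding steps. -/
def decodeLaw (D : PMF ℕ) (k n t : ℕ) : PMF ((Fin n → Finset (Fin k)) × Finset (Fin k)) :=
  (iidLaw (symbolLaw D k) n).bind fun N => (decode N t).map fun U => (N, U)

/-- The probability that decoding from `n` received output symbols reaches the state in which
exactly `m` of the `k` information symbols are unrecovered (`m ≤ k`).  Each step before halting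
recovers exactly one symbol, so this is the event that `m` are unrecovered after `k - m` steps. -/
def reachProb (D : PMF ℕ) (k n m : ℕ) : ℝ :=
  ∑ s : (Fin n → Finset (Fin k)) × Finset (Fin k),
    if s.2.card = m then (decodeLaw D k n (k - m) s).toReal else 0

/-- The expected size of the ripple when `m` of the `k` information symbols are unrecovered, for
`n` received output symbols: the conditional expectation given that this state is reached. -/
def expectedRipple (D : PMF ℕ) (k n m : ℕ) : ℝ :=
  (∑ s : (Fin n → Finset (Fin k)) × Finset (Fin k),
    if s.2.card = m then (decodeLaw D k n (k - m) s).toReal * ((ripple s.1 s.2).card : ℝ)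
    else 0) / reachProb D k n m

/-- The normalized expected ripple size at unrecovered fraction `u` when `w * k` output symbols
have been collected. -/
def normalizedRipple (D : PMF ℕ) (k : ℕ) (w u : ℝ) : ℝ :=
  expectedRipple D k ⌊w * k⌋₊ ⌊u * k⌋₊ / k

/-- The generating function `x ↦ ∑ p i * x ^ i`. -/
def genFun (p : ℕ → ℝ) (x : ℝ) : ℝ := ∑' i, p i * x ^ i

end LTCode

end

namespace LTCode

variable {k n : ℕ}

/-! The ripple concentrates, and this is proved by a second moment bound for a fixed target set `T`
of `m` information symbols. Let `R` be the number of output symbols with exactly one neighbour in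
`T`. While `T` lies inside the unrecovered set `U`, the released symbol is uniform on `U` given the
rest of the data (`releaseSum_eq_of_mem`). A step therefore misses `T` with probability `1 -
|T|/|U|`. By convexity of the square, the second moment of `R` about `c` before the step controls
the one about `c - |T|/|U|` after a step that misses `T` (`stageSum_succ_le`).

The survival factors telescope to `1 / k.choose m`, and the shifts of `c` add up to `m (H_k - H_m)`.
At the start `R` is a sum of `n` independent indicators, with variance at most `n`. Summing over the
`k.choose m` sets `T` bounds by `n` the second moment of the ripple about `predictedRipple` on the
event that the stage is reached (`sum_ripple_sq_le`). By Cauchy–Schwarz the conditional mean differs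
from the prediction by `O(√k)` when the stage has probability bounded below.

After division by `k` the prediction tends to `u (w P'(1-u) + log u)`. This is affine in `w`, and
the ripple is at most the number of collected symbols, so dominated convergence gives the mean over
`W`. -/

/-! ### Transition probabilities of the decoder -/

theorem step_apply_toReal_of_ne (N : Fin n → Finset (Fin k)) {U V : Finset (Fin k)}
    (hUV : U ≠ V) :
    (step N V U).toReal =
      (((ripple N V).filter fun i => V \ N i = U).card : ℝ) / ((ripple N V).card : ℝ) := by
  unfold step
  split_ifs with h
  · rw [PMF.map_apply, tsum_fintype]
    simp only [PMF.uniformOfFinset_apply]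
    rw [ENNReal.toReal_sum (fun i _ => by split_ifs <;> simp [h.ne_empty])]
    rw [div_eq_mul_inv, Finset.card_filter, Nat.cast_sum, Finset.sum_mul,
      ← Finset.sum_filter_add_sum_filter_not Finset.univ (fun i => i ∈ ripple N V)]
    rw [Finset.filter_univ_mem, Finset.sum_eq_zero (s := Finset.filter _ _), add_zero]
    · refine Finset.sum_congr rfl fun i hi => ?_
      by_cases hi' : V \ N i = U
      · simp [hi', hi]
      · simp [hi', Ne.symm hi']
    · intro i hi
      simp only [Finset.mem_filter] at hi
      simp [hi.2]
  · rw [Finset.not_nonempty_iff_eq_empty] at h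
    simp [h, PMF.pure_apply, hUV]

theorem le_card_add_of_decode_ne_zero (N : Fin n → Finset (Fin k)) (t : ℕ) (U : Finset (Fin k))
    (hU : decode N t U ≠ 0) : k ≤ U.card + t := by
  induction t generalizing U with
  | zero =>
    have : U = Finset.univ := by
      by_contra h
      exact hU (by simp [decode, PMF.pure_apply, h])
    simp [this]
  | succ t ih =>
    have h1 : U ∈ (decode N (t + 1)).support := hU
    rw [decode, PMF.mem_support_bind_iff] at h1
    obtain ⟨V, hV, hUV⟩ := h1
    have hV' := ih V hV
    by_cases h : U = V
    · subst h; omega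
    have h2 : (step N V U).toReal ≠ 0 := by
      rw [ENNReal.toReal_ne_zero]
      exact ⟨hUV, PMF.apply_ne_top _ _⟩
    rw [step_apply_toReal_of_ne N h] at h2
    have h3 : ((ripple N V).filter fun i => V \ N i = U).Nonempty := by
      by_contra hne
      rw [Finset.not_nonempty_iff_eq_empty] at hne
      simp [hne] at h2
    obtain ⟨i, hi⟩ := h3
    simp only [Finset.mem_filter, ripple, Finset.mem_univ, true_and] at hi
    have := Finset.card_inter_add_card_sdiff V (N i)
    rw [Finset.inter_comm, hi.1, hi.2] at this
    omega

theorem decode_succ_toReal (N : Fin n → Finset (Fin k)) (t : ℕ) (U : Finset (Fin k))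
    (hU : U.card + (t + 1) = k) :
    (decode N (t + 1) U).toReal = ∑ x ∈ Uᶜ, (decode N t (insert x U)).toReal *
      (((Finset.univ.filter fun i => N i ∩ insert x U = {x}).card : ℝ) /
        ((ripple N (insert x U)).card : ℝ)) := by
  have hinj : Set.InjOn (fun x => insert x U) (Uᶜ : Finset (Fin k)) := by
    intro x hx y hy hxy
    simp only [Finset.coe_compl, Set.mem_compl_iff, Finset.mem_coe] at hx hy
    have : x ∈ insert y U := by
      have h : insert x U = insert y U := hxy
      rw [← h]; simp
    simpa [hx] using this
  rw [decode, PMF.bind_apply, tsum_fintype, ENNReal.toReal_sum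
    (fun V _ => ENNReal.mul_ne_top (PMF.apply_ne_top _ _) (PMF.apply_ne_top _ _))]
  rw [← Finset.sum_subset (Finset.subset_univ (Uᶜ.image fun x => insert x U)),
    Finset.sum_image hinj]
  · refine Finset.sum_congr rfl fun x hx => ?_
    rw [Finset.mem_compl] at hx
    have hne : U ≠ insert x U := fun h => hx (by rw [h]; simp)
    rw [ENNReal.toReal_mul, step_apply_toReal_of_ne N hne]
    congr 4
    ext i
    simp only [ripple, Finset.mem_filter, Finset.mem_univ, true_and]
    constructor
    · rintro ⟨h1, h2⟩
      obtain ⟨y, hy⟩ := Finset.card_eq_one.mp h1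
      have hxi : x ∈ N i := by
        by_contra hxi
        exact hx (h2 ▸ Finset.mem_sdiff.mpr ⟨by simp, hxi⟩)
      have hxy : x ∈ N i ∩ insert x U := by simp [hxi]
      rw [hy] at hxy ⊢
      rw [Finset.mem_singleton.mp hxy]
    · intro h
      refine ⟨by simp [h], ?_⟩
      rw [← Finset.sdiff_inter_self_right, h]
      rw [Finset.sdiff_singleton_eq_erase, Finset.erase_insert hx]
  · intro V _ hV
    rw [ENNReal.toReal_mul]
    by_cases h0 : decode N t V = 0
    · simp [h0]
    -- A possible `V` at time `t` has at least `k - t` elements, more than `U`, so staying put in a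
    -- halted state cannot produce `U`.
    have hk := le_card_add_of_decode_ne_zero N t V h0
    have hne : U ≠ V := by rintro rfl; omega
    rw [step_apply_toReal_of_ne N hne]
    rw [Finset.filter_eq_empty_iff.mpr, Finset.card_empty]
    · simp
    intro i hi hVi
    apply hV
    simp only [ripple, Finset.mem_filter, Finset.mem_univ, true_and] at hi
    obtain ⟨y, hy⟩ := Finset.card_eq_one.mp hi
    have hyV : y ∈ V := by
      have : y ∈ N i ∩ V := by simp [hy]
      exact (Finset.mem_inter.mp this).2
    have hU' : U = V \ {y} := by rw [← hVi, ← hy, Finset.sdiff_inter_self_right]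
    simp only [Finset.mem_image, Finset.mem_compl]
    exact ⟨y, by simp [hU'], by rw [hU', Finset.sdiff_singleton_eq_erase,
      Finset.insert_erase hyV]⟩

/-- The probability of ending with the unrecovered set `U` only depends on how many neighbours
each output symbol has in `U`, not on which ones. -/
theorem decode_toReal_congr (N N' : Fin n → Finset (Fin k)) (t : ℕ) (U : Finset (Fin k))
    (hU : U.card + t = k) (hout : ∀ j, ∀ x ∉ U, x ∈ N j ↔ x ∈ N' j)
    (hin : ∀ j, (N j ∩ U).card = (N' j ∩ U).card) :
    (decode N t U).toReal = (decode N' t U).toReal := by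
  induction t generalizing U with
  | zero => rfl
  | succ t ih =>
    rw [decode_succ_toReal N t U hU, decode_succ_toReal N' t U hU]
    refine Finset.sum_congr rfl fun x hx => ?_
    rw [Finset.mem_compl] at hx
    have hcard : ∀ j, (N j ∩ insert x U).card = (N' j ∩ insert x U).card := by
      intro j
      by_cases hxj : x ∈ N j
      · rw [Finset.inter_insert_of_mem hxj,
          Finset.inter_insert_of_mem ((hout j x hx).mp hxj), Finset.card_insert_of_notMem
          (by simp [hx]), Finset.card_insert_of_notMem (by simp [hx]), hin j]
      · rw [Finset.inter_insert_of_notMem hxj,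
          Finset.inter_insert_of_notMem (fun h => hxj ((hout j x hx).mpr h)), hin j]
    have hsing : ∀ (M : Fin n → Finset (Fin k)) j,
        M j ∩ insert x U = {x} ↔ x ∈ M j ∧ (M j ∩ insert x U).card = 1 := by
      intro M j
      constructor
      · intro h
        have : x ∈ M j ∩ insert x U := by simp [h]
        exact ⟨(Finset.mem_inter.mp this).1, by simp [h]⟩
      · rintro ⟨h1, h2⟩
        obtain ⟨y, hy⟩ := Finset.card_eq_one.mp h2
        have : x ∈ M j ∩ insert x U := by simp [h1]
        rw [hy] at this ⊢
        rw [Finset.mem_singleton.mp this]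
    have hr : ripple N (insert x U) = ripple N' (insert x U) := by
      ext j; simp [ripple, hcard]
    have hf : (Finset.univ.filter fun i => N i ∩ insert x U = {x}) =
        (Finset.univ.filter fun i => N' i ∩ insert x U = {x}) := by
      ext j; simp only [Finset.mem_filter, hsing, hcard, hout j x hx]
    rw [ih (insert x U) (by rw [Finset.card_insert_of_notMem hx]; omega)
      (fun j y hy => hout j y (fun h => hy (Finset.mem_insert_of_mem h))) hcard, hr, hf]

/-! ### Exchangeability and the second moment recursion -/

/-- The weight of the outcome `(N, U)` at time `t`, divided by the size of the ripple. -/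
noncomputable def selectionWeight (q : Finset (Fin k) → ℝ) (t : ℕ) (U : Finset (Fin k))
    (N : Fin n → Finset (Fin k)) : ℝ :=
  (∏ j, q (N j)) * (decode N t U).toReal / ((ripple N U).card : ℝ)

/-- The sum of `f` over the outcomes at time `t` with unrecovered set `U` in which the output
symbol `i` is selected and releases the information symbol `x`. -/
noncomputable def releaseSum (q : Finset (Fin k) → ℝ) (t : ℕ) (U : Finset (Fin k)) (i : Fin n)
    (x : Fin k) (f : (Fin n → Finset (Fin k)) → ℝ) : ℝ :=
  ∑ N, selectionWeight q t U N * if N i ∩ U = {x} then f N else 0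

/-- The second moment about `c` of the number of output symbols with exactly one neighbour in `T`,
summed over the outcomes at time `t` in which `T` is unrecovered and decoding has not halted. -/
noncomputable def stageSum (n : ℕ) (q : Finset (Fin k) → ℝ) (T : Finset (Fin k)) (t : ℕ)
    (c : ℝ) : ℝ :=
  ∑ U ∈ Finset.univ.filter (fun U : Finset (Fin k) => T ⊆ U ∧ U.card + t = k),
    ∑ N : Fin n → Finset (Fin k),
      (∏ j, q (N j)) * (decode N t U).toReal * (((ripple N T).card : ℝ) - c) ^ 2

theorem selectionWeight_nonneg {q : Finset (Fin k) → ℝ} (hq : ∀ S, 0 ≤ q S) (t : ℕ)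
    (U : Finset (Fin k)) (N : Fin n → Finset (Fin k)) : 0 ≤ selectionWeight q t U N := by
  unfold selectionWeight
  have := Finset.prod_nonneg fun j (_ : j ∈ Finset.univ) => hq (N j)
  positivity

/-- Exchangeability: swapping `x` and `y` inside the neighbourhood of `i` alone is a bijection of
outcomes. It keeps every degree, every intersection size with `U` and everything outside `U`, hence
the selection weight. The hypothesis `hf` makes `f` blind to the change. -/
theorem releaseSum_eq_of_mem {q : Finset (Fin k) → ℝ}
    (hqc : ∀ S S' : Finset (Fin k), S.card = S'.card → q S = q S') {t : ℕ} {U : Finset (Fin k)}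
    (hU : U.card + t = k) (i : Fin n) {x y : Fin k} (hx : x ∈ U) (hy : y ∈ U)
    (f : (Fin n → Finset (Fin k)) → ℝ) (hf : ∀ N S, f (Function.update N i S) = f N) :
    releaseSum q t U i x f = releaseSum q t U i y f := by
  let sw : Finset (Fin k) → Finset (Fin k) := fun S => S.map (Equiv.swap x y).toEmbedding
  have hmem : ∀ S z, z ∈ sw S ↔ Equiv.swap x y z ∈ S := by
    intro S z
    simp only [sw, Finset.mem_map_equiv, Equiv.symm_swap]
  have hsw : ∀ S, sw (sw S) = S := by
    intro S; ext z; simp [hmem]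
  have hmemU : ∀ z, Equiv.swap x y z ∈ U ↔ z ∈ U := by
    intro z
    rcases eq_or_ne z x with rfl | hzx
    · simp [hx, hy]
    rcases eq_or_ne z y with rfl | hzy
    · simp [hx, hy]
    rw [Equiv.swap_apply_of_ne_of_ne hzx hzy]
  have hswU : ∀ S, sw S ∩ U = sw (S ∩ U) := by
    intro S; ext z; simp [hmem, hmemU]
  have hswcard : ∀ S, (sw S).card = S.card := fun S => Finset.card_map _
  let e : (Fin n → Finset (Fin k)) → (Fin n → Finset (Fin k)) :=
    fun N => Function.update N i (sw (N i))
  have he : Function.Involutive e := by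
    intro N
    simp [e, hsw]
  have hei : ∀ N, e N i = sw (N i) := fun N => by simp [e]
  have hej : ∀ N j, j ≠ i → e N j = N j := fun N j hj => by simp [e, hj]
  unfold releaseSum
  refine Fintype.sum_equiv he.toPerm _ _ fun N => ?_
  have hcard : ∀ j, (N j ∩ U).card = (e N j ∩ U).card := by
    intro j
    rcases eq_or_ne j i with rfl | hj
    · rw [hei, hswU, hswcard]
    · rw [hej N j hj]
  have hout : ∀ j, ∀ z ∉ U, z ∈ N j ↔ z ∈ e N j := by
    intro j z hz
    rcases eq_or_ne j i with rfl | hj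
    · rw [hei, hmem, Equiv.swap_apply_of_ne_of_ne (fun h : z = x => hz (h ▸ hx))
        (fun h : z = y => hz (h ▸ hy))]
    · rw [hej N j hj]
  have hq' : ∀ j, q (N j) = q (e N j) := by
    intro j
    rcases eq_or_ne j i with rfl | hj
    · rw [hei]; exact hqc _ _ (hswcard _).symm
    · rw [hej N j hj]
  have hw : selectionWeight q t U N = selectionWeight q t U (e N) := by
    unfold selectionWeight
    rw [decode_toReal_congr N (e N) t U hU hout hcard, Finset.prod_congr rfl fun j _ => hq' j]
    have hr : ripple N U = ripple (e N) U := by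
      ext j
      simp [ripple, hcard]
    rw [hr]
  have hxy : N i ∩ U = {x} ↔ e N i ∩ U = {y} := by
    rw [hei, hswU]
    have h1 : sw {x} = {y} := by simp [sw]
    rw [← h1]
    constructor
    · intro h; rw [h]
    · intro h; rw [← hsw (N i ∩ U), h, hsw]
  have hfe : f (e N) = f N := hf _ _
  show _ = selectionWeight q t U (e N) * if e N i ∩ U = {y} then f (e N) else 0
  rw [hw, hfe]
  simp only [hxy]

theorem releaseSum_mono {q : Finset (Fin k) → ℝ} (hq : ∀ S, 0 ≤ q S) (t : ℕ)
    (U : Finset (Fin k)) (i : Fin n) (x : Fin k) {f g : (Fin n → Finset (Fin k)) → ℝ}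
    (hfg : ∀ N, f N ≤ g N) : releaseSum q t U i x f ≤ releaseSum q t U i x g := by
  refine Finset.sum_le_sum fun N _ => mul_le_mul_of_nonneg_left ?_
    (selectionWeight_nonneg hq t U N)
  split_ifs
  · exact hfg N
  · rfl

theorem releaseSum_linear (q : Finset (Fin k) → ℝ) (t : ℕ)
    (U : Finset (Fin k)) (i : Fin n) (x : Fin k) (f g : (Fin n → Finset (Fin k)) → ℝ) (a b : ℝ) :
    releaseSum q t U i x (fun N => a * f N + b * g N) =
      a * releaseSum q t U i x f + b * releaseSum q t U i x g := by
  unfold releaseSum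
  rw [Finset.mul_sum, Finset.mul_sum, ← Finset.sum_add_distrib]
  refine Finset.sum_congr rfl fun N _ => ?_
  split_ifs <;> ring

/-- The new unrecovered set with the released symbol added back is the old one, and it still
contains `T` after the release exactly when `x ∉ T`. Erasing `i` then changes nothing, but it makes
the summand independent of the neighbourhood of `i`, as exchangeability requires. -/
theorem stageSum_succ (q : Finset (Fin k) → ℝ) (T : Finset (Fin k)) (t : ℕ) (c : ℝ) :
    stageSum n q T (t + 1) c =
      ∑ U ∈ Finset.univ.filter (fun U : Finset (Fin k) => T ⊆ U ∧ U.card + t = k),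
        ∑ i : Fin n, ∑ x ∈ U \ T, releaseSum q t U i x
          (fun N => ((((ripple N T).erase i).card : ℝ) - c) ^ 2) := by
  have h1 : stageSum n q T (t + 1) c =
      ∑ U ∈ Finset.univ.filter (fun U : Finset (Fin k) => T ⊆ U ∧ U.card + (t + 1) = k),
        ∑ x ∈ Uᶜ, ∑ i : Fin n, releaseSum q t (insert x U) i x
          (fun N => (((ripple N T).card : ℝ) - c) ^ 2) := by
    unfold stageSum releaseSum
    refine Finset.sum_congr rfl fun U hU => ?_
    simp only [Finset.mem_filter, Finset.mem_univ, true_and] at hU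
    rw [Finset.sum_congr rfl fun x _ => Finset.sum_comm, Finset.sum_comm]
    refine Finset.sum_congr rfl fun N _ => ?_
    rw [decode_succ_toReal N t U hU.2, Finset.mul_sum, Finset.sum_mul]
    refine Finset.sum_congr rfl fun x _ => ?_
    rw [← Finset.mul_sum, ← Finset.sum_filter, Finset.sum_const, nsmul_eq_mul, selectionWeight]
    ring
  have h2 : ∀ U : Finset (Fin k), (∑ i : Fin n, ∑ x ∈ U \ T, releaseSum q t U i x
      (fun N => ((((ripple N T).erase i).card : ℝ) - c) ^ 2)) =
      ∑ x ∈ U \ T, ∑ i : Fin n, releaseSum q t U i x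
        (fun N => ((((ripple N T).erase i).card : ℝ) - c) ^ 2) := fun U => Finset.sum_comm
  simp only [h2]
  rw [h1]
  refine (Finset.sum_sigma' _ _ _).trans (Eq.trans ?_ (Finset.sum_sigma' _ _ _).symm)
  refine Finset.sum_bij' (fun p _ => ⟨insert p.2 p.1, p.2⟩) (fun p _ => ⟨p.1.erase p.2, p.2⟩)
    ?_ ?_ ?_ ?_ ?_
  · rintro ⟨U, x⟩ h
    simp only [Finset.mem_sigma, Finset.mem_filter, Finset.mem_univ, true_and,
      Finset.mem_compl, Finset.mem_sdiff] at h ⊢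
    obtain ⟨⟨hTU, hUt⟩, hx⟩ := h
    refine ⟨⟨hTU.trans (Finset.subset_insert _ _), ?_⟩, by simp, fun h => hx (hTU h)⟩
    rw [Finset.card_insert_of_notMem hx]
    omega
  · rintro ⟨U, x⟩ h
    simp only [Finset.mem_sigma, Finset.mem_filter, Finset.mem_univ, true_and,
      Finset.mem_compl, Finset.mem_sdiff] at h ⊢
    obtain ⟨⟨hTU, hUt⟩, hxU, hxT⟩ := h
    refine ⟨⟨Finset.subset_erase.mpr ⟨hTU, hxT⟩, ?_⟩, by simp⟩
    have := Finset.card_erase_add_one hxU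
    omega
  · rintro ⟨U, x⟩ h
    simp only [Finset.mem_sigma, Finset.mem_compl] at h
    simp [Finset.erase_insert h.2]
  · rintro ⟨U, x⟩ h
    simp only [Finset.mem_sigma, Finset.mem_sdiff] at h
    simp [Finset.insert_erase h.2.1]
  · rintro ⟨U, x⟩ h
    simp only [Finset.mem_sigma, Finset.mem_filter, Finset.mem_univ, true_and,
      Finset.mem_compl] at h
    obtain ⟨⟨hTU, hUt⟩, hx⟩ := h
    refine Finset.sum_congr rfl fun i _ => Finset.sum_congr rfl fun N _ => ?_
    dsimp only
    congr 1
    split_ifs with hN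
    · rw [Finset.erase_eq_of_notMem]
      intro hi
      simp only [ripple, Finset.mem_filter, Finset.mem_univ, true_and] at hi
      obtain ⟨y, hy⟩ := Finset.card_eq_one.mp hi
      have hyT : y ∈ N i ∩ T := by simp [hy]
      rw [Finset.mem_inter] at hyT
      have : y ∈ N i ∩ insert x U := by simp [hyT.1, hTU hyT.2]
      rw [hN, Finset.mem_singleton] at this
      exact hx (hTU (this ▸ hyT.2))
    · rfl

/-- Each outcome is split over the selected `i` and the released `x`; the ripple has as many choices
of `i` as the weight divides by. Only an inequality holds, since an empty ripple has weight `0` by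
division by zero. -/
theorem sum_releaseSum_le_stageSum {q : Finset (Fin k) → ℝ} (hq : ∀ S, 0 ≤ q S)
    (T : Finset (Fin k)) (t : ℕ) (c : ℝ) :
    ∑ U ∈ Finset.univ.filter (fun U : Finset (Fin k) => T ⊆ U ∧ U.card + t = k),
        ∑ i : Fin n, ∑ x ∈ U, releaseSum q t U i x
          (fun N => ((((ripple N T).erase i).card : ℝ) + (if x ∈ T then 1 else 0) - c) ^ 2) ≤
      stageSum n q T t c := by
  unfold stageSum releaseSum
  refine Finset.sum_le_sum fun U hU => ?_
  simp only [Finset.mem_filter, Finset.mem_univ, true_and] at hU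
  rw [Finset.sum_congr rfl fun i _ => Finset.sum_comm, Finset.sum_comm]
  refine Finset.sum_le_sum fun N _ => ?_
  have h1 : ∀ i : Fin n, (∑ x ∈ U, selectionWeight q t U N * if N i ∩ U = {x} then
      ((((ripple N T).erase i).card : ℝ) + (if x ∈ T then 1 else 0) - c) ^ 2 else 0) =
      if i ∈ ripple N U then selectionWeight q t U N * (((ripple N T).card : ℝ) - c) ^ 2
        else 0 := by
    intro i
    by_cases hi : i ∈ ripple N U
    · rw [if_pos hi]
      simp only [ripple, Finset.mem_filter, Finset.mem_univ, true_and] at hi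
      obtain ⟨y, hy⟩ := Finset.card_eq_one.mp hi
      have hyU : y ∈ N i ∩ U := by simp [hy]
      rw [Finset.mem_inter] at hyU
      rw [Finset.sum_eq_single_of_mem y hyU.2]
      · rw [if_pos hy]
        have hT : N i ∩ T = if y ∈ T then {y} else ∅ := by
          have h0 : N i ∩ T = {y} ∩ T := by
            rw [← hy, Finset.inter_assoc, Finset.inter_eq_right.mpr hU.1]
          rw [h0]
          split_ifs with h
          · simp [h]
          · simp [h]
        congr 3
        by_cases h : y ∈ T
        · have hm : i ∈ ripple N T := by simp [ripple, hT, h]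
          rw [if_pos h]
          exact_mod_cast Finset.card_erase_add_one hm
        · have hm : i ∉ ripple N T := by simp [ripple, hT, h]
          rw [if_neg h, Finset.erase_eq_of_notMem hm, add_zero]
      · intro x _ hxy
        rw [if_neg, mul_zero]
        intro h
        exact hxy (Finset.singleton_injective (h.symm.trans hy))
    · rw [if_neg hi]
      refine Finset.sum_eq_zero fun x _ => ?_
      rw [if_neg, mul_zero]
      intro h
      exact hi (by simp [ripple, h])
  rw [Finset.sum_congr rfl fun i _ => h1 i, ← Finset.sum_filter, Finset.filter_univ_mem,
    Finset.sum_const, nsmul_eq_mul, selectionWeight]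
  have hP := Finset.prod_nonneg fun j (_ : j ∈ Finset.univ) => hq (N j)
  rw [← mul_assoc]
  refine mul_le_mul_of_nonneg_right ?_ (sq_nonneg _)
  by_cases h0 : ((ripple N U).card : ℝ) = 0
  · rw [h0, zero_mul]; positivity
  · rw [mul_div_cancel₀ _ h0]

/-- All `x ∈ U` being equally likely, `i` itself contributes to the count on `T` with probability
`|T|/m`. Averaging over `x` first and applying Jensen to the square replaces this contribution by
its mean, which is the shift of `c`. -/
theorem stageSum_succ_le {q : Finset (Fin k) → ℝ} (hq : ∀ S, 0 ≤ q S)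
    (hqc : ∀ S S' : Finset (Fin k), S.card = S'.card → q S = q S')
    (T : Finset (Fin k)) (t m : ℕ) (hm : m + t = k) (hT : T.card < m) (c : ℝ) :
    m * stageSum n q T (t + 1) (c - T.card / m) ≤ (m - T.card) * stageSum n q T t c := by
  have hTm : (T.card : ℝ) < m := by exact_mod_cast hT
  have hm0 : (0 : ℝ) < m := lt_of_le_of_lt (Nat.cast_nonneg _) hTm
  refine le_trans ?_ (mul_le_mul_of_nonneg_left (sum_releaseSum_le_stageSum hq T t c)
    (sub_nonneg.mpr hTm.le))
  rw [stageSum_succ, Finset.mul_sum, Finset.mul_sum]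
  refine Finset.sum_le_sum fun U hU => ?_
  simp only [Finset.mem_filter, Finset.mem_univ, true_and] at hU
  obtain ⟨hTU, hUt⟩ := hU
  have hUm : U.card = m := by omega
  rw [Finset.mul_sum, Finset.mul_sum]
  refine Finset.sum_le_sum fun i _ => ?_
  obtain ⟨x₀, hx₀⟩ : U.Nonempty := Finset.card_pos.mp (by omega)
  have herase : ∀ (N : Fin n → Finset (Fin k)) (S : Finset (Fin k)),
      (ripple (Function.update N i S) T).erase i = (ripple N T).erase i := by
    intro N S
    ext j
    by_cases hj : j = i <;> simp [ripple, hj]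
  have hR : ∀ a : ℝ, ∀ x ∈ U, releaseSum q t U i x
      (fun N => ((((ripple N T).erase i).card : ℝ) + a - c) ^ 2) = releaseSum q t U i x₀
      (fun N => ((((ripple N T).erase i).card : ℝ) + a - c) ^ 2) := fun a x hx =>
    releaseSum_eq_of_mem hqc hUt i hx hx₀ _ fun N S => by rw [herase]
  have hL : ∀ x ∈ U \ T, releaseSum q t U i x
      (fun N => ((((ripple N T).erase i).card : ℝ) - (c - T.card / m)) ^ 2) =
      releaseSum q t U i x₀
      (fun N => ((((ripple N T).erase i).card : ℝ) - (c - T.card / m)) ^ 2) := fun x hx =>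
    releaseSum_eq_of_mem hqc hUt i (Finset.mem_sdiff.mp hx).1 hx₀ _ fun N S => by rw [herase]
  have hcard : ((U \ T).card : ℝ) = m - T.card := by
    rw [Finset.card_sdiff_of_subset hTU, Nat.cast_sub (Finset.card_le_card hTU), hUm]
  have hin : ∑ x ∈ T, releaseSum q t U i x
      (fun N => ((((ripple N T).erase i).card : ℝ) + (if x ∈ T then 1 else 0) - c) ^ 2) =
      T.card * releaseSum q t U i x₀
        (fun N => ((((ripple N T).erase i).card : ℝ) + 1 - c) ^ 2) := by
    rw [← nsmul_eq_mul, ← Finset.sum_const]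
    refine Finset.sum_congr rfl fun x hx => ?_
    simp only [if_pos hx]
    exact hR 1 x (hTU hx)
  have hout : ∑ x ∈ U \ T, releaseSum q t U i x
      (fun N => ((((ripple N T).erase i).card : ℝ) + (if x ∈ T then 1 else 0) - c) ^ 2) =
      (m - T.card) * releaseSum q t U i x₀
        (fun N => ((((ripple N T).erase i).card : ℝ) + 0 - c) ^ 2) := by
    rw [← hcard, ← nsmul_eq_mul, ← Finset.sum_const]
    refine Finset.sum_congr rfl fun x hx => ?_
    simp only [if_neg (Finset.mem_sdiff.mp hx).2]
    exact hR 0 x (Finset.mem_sdiff.mp hx).1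
  rw [Finset.sum_congr rfl hL, Finset.sum_const, nsmul_eq_mul, hcard,
    ← Finset.sum_sdiff hTU, hin, hout, mul_left_comm]
  refine mul_le_mul_of_nonneg_left ?_ (sub_nonneg.mpr hTm.le)
  rw [← releaseSum_linear]
  have h0 := releaseSum_linear q t U i x₀
    (fun N => ((((ripple N T).erase i).card : ℝ) - (c - T.card / m)) ^ 2) (fun _ => 0) m 0
  simp only [zero_mul, add_zero] at h0
  rw [← h0]
  refine releaseSum_mono hq t U i x₀ fun N => ?_
  generalize (((ripple N T).erase i).card : ℝ) = r
  -- The Jensen gap is `m` times the variance of a Bernoulli variable of parameter `|T|/m`.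
  have key : (m - T.card) * (r + 0 - c) ^ 2 + T.card * (r + 1 - c) ^ 2 -
      (m * (r - (c - T.card / m)) ^ 2) = (m - T.card) * T.card / m := by
    field_simp
    ring
  have : 0 ≤ ((m : ℝ) - T.card) * T.card / m := by
    have := sub_nonneg.mpr hTm.le
    positivity
  linarith

/-! ### Moments of independent sums and the initial variance -/

theorem sum_prod_eq_one {α : Type} [Fintype α] {q : α → ℝ} (hq1 : ∑ a, q a = 1) (n : ℕ) :
    ∑ N : Fin n → α, ∏ j, q (N j) = 1 := by
  classical
  rw [← Fintype.prod_sum (fun (_ : Fin n) a => q a)]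
  simp [hq1]

theorem sum_prod_mul_sum_eq_zero {α : Type} [Fintype α] {q : α → ℝ} (hq1 : ∑ a, q a = 1)
    {f : α → ℝ} (hf : ∑ a, q a * f a = 0) (n : ℕ) :
    ∑ N : Fin n → α, (∏ j, q (N j)) * ∑ j, f (N j) = 0 := by
  induction n with
  | zero => simp
  | succ n ih =>
    rw [← (Fin.consEquiv fun _ => α).sum_comp, Fintype.sum_prod_type]
    have h : ∀ (a : α) (N : Fin n → α),
        (∏ j, q ((Fin.consEquiv fun _ => α) (a, N) j)) *
          ∑ j, f ((Fin.consEquiv fun _ => α) (a, N) j) =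
        (q a * f a) * (∏ j, q (N j)) + q a * ((∏ j, q (N j)) * ∑ j, f (N j)) := by
      intro a N
      simp only [Fin.consEquiv_apply, Fin.prod_univ_succ, Fin.sum_univ_succ, Fin.cons_zero,
        Fin.cons_succ]
      ring
    simp_rw [h, Finset.sum_add_distrib, ← Finset.mul_sum, ih, sum_prod_eq_one hq1]
    simp [hf]

/-- The variance of a sum of independent, identically distributed centred variables. -/
theorem sum_prod_mul_sum_sq {α : Type} [Fintype α] {q : α → ℝ} (hq1 : ∑ a, q a = 1)
    {f : α → ℝ} (hf : ∑ a, q a * f a = 0) (n : ℕ) :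
    ∑ N : Fin n → α, (∏ j, q (N j)) * (∑ j, f (N j)) ^ 2 = n * ∑ a, q a * f a ^ 2 := by
  induction n with
  | zero => simp
  | succ n ih =>
    rw [← (Fin.consEquiv fun _ => α).sum_comp, Fintype.sum_prod_type]
    have h : ∀ (a : α) (N : Fin n → α),
        (∏ j, q ((Fin.consEquiv fun _ => α) (a, N) j)) *
          (∑ j, f ((Fin.consEquiv fun _ => α) (a, N) j)) ^ 2 =
        (q a * f a ^ 2) * (∏ j, q (N j)) +
          (2 * (q a * f a)) * ((∏ j, q (N j)) * ∑ j, f (N j)) +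
          q a * ((∏ j, q (N j)) * (∑ j, f (N j)) ^ 2) := by
      intro a N
      simp only [Fin.consEquiv_apply, Fin.prod_univ_succ, Fin.sum_univ_succ, Fin.cons_zero,
        Fin.cons_succ]
      ring
    simp_rw [h, Finset.sum_add_distrib, ← Finset.mul_sum, ih, sum_prod_mul_sum_eq_zero hq1 hf,
      sum_prod_eq_one hq1]
    simp only [mul_one, mul_zero, Finset.sum_const_zero, add_zero, ← Finset.sum_mul, hq1]
    push_cast
    ring

theorem stageSum_zero_le {q : Finset (Fin k) → ℝ} (hq : ∀ S, 0 ≤ q S) (hq1 : ∑ S, q S = 1)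
    (T : Finset (Fin k)) (n : ℕ) :
    stageSum n q T 0 (n * ∑ S, q S * if (S ∩ T).card = 1 then 1 else 0) ≤ n := by
  set h : ℝ := ∑ S, q S * if (S ∩ T).card = 1 then 1 else 0 with hh
  have hfil : Finset.univ.filter (fun U : Finset (Fin k) => T ⊆ U ∧ U.card + 0 = k) =
      {Finset.univ} := by
    ext U
    simp only [Finset.mem_filter, Finset.mem_univ, true_and, Finset.mem_singleton, add_zero]
    constructor
    · rintro ⟨_, h⟩
      exact Finset.card_eq_iff_eq_univ U |>.mp (by simpa using h)
    · rintro rfl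
      simp
  have h0 : 0 ≤ h := Finset.sum_nonneg fun S _ => mul_nonneg (hq S) (by split_ifs <;> norm_num)
  have h1 : h ≤ 1 := by
    rw [← hq1]
    refine Finset.sum_le_sum fun S _ => ?_
    have := hq S
    split_ifs <;> linarith
  let f : Finset (Fin k) → ℝ := fun S => (if (S ∩ T).card = 1 then 1 else 0) - h
  have hf : ∑ S, q S * f S = 0 := by
    simp only [f, mul_sub, Finset.sum_sub_distrib, ← Finset.sum_mul, hq1]
    rw [← hh]; ring
  have hsum : ∀ N : Fin n → Finset (Fin k), ((ripple N T).card : ℝ) - n * h = ∑ j, f (N j) := by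
    intro N
    simp [f, ripple]
  unfold stageSum
  rw [hfil, Finset.sum_singleton]
  simp_rw [hsum, decode, PMF.pure_apply_self, ENNReal.toReal_one, mul_one]
  rw [sum_prod_mul_sum_sq hq1 hf]
  have : ∑ S, q S * f S ^ 2 ≤ 1 := by
    rw [← hq1]
    refine Finset.sum_le_sum fun S _ => mul_le_of_le_one_right (hq S) ?_
    rw [sq_le_one_iff_abs_le_one, abs_le]
    simp only [f]
    split_ifs <;> constructor <;> linarith
  exact mul_le_of_le_one_right (Nat.cast_nonneg n) this

/-! ### Telescoping down to the target stage -/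

theorem choose_mul_stageSum_le {q : Finset (Fin k) → ℝ} (hq : ∀ S, 0 ≤ q S)
    (hqc : ∀ S S' : Finset (Fin k), S.card = S'.card → q S = q S')
    (T : Finset (Fin k)) (c : ℝ) (t : ℕ) (ht : T.card + t ≤ k) :
    (k.choose T.card) * stageSum n q T t (c - T.card * ∑ s ∈ Finset.range t, ((k - s : ℕ) : ℝ)⁻¹)
      ≤ ((k - t).choose T.card) * stageSum n q T 0 c := by
  induction t with
  | zero => simp
  | succ t ih =>
    have ih := ih (by omega)
    obtain ⟨m, hm⟩ : ∃ m, k = m + 1 + t := ⟨k - (t + 1), by omega⟩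
    have hmt : k - t = m + 1 := by omega
    have hmt' : k - (t + 1) = m := by omega
    have hstep := stageSum_succ_le (n := n) hq hqc T t (m + 1) hm.symm (by omega)
      (c - T.card * ∑ s ∈ Finset.range t, ((k - s : ℕ) : ℝ)⁻¹)
    rw [Finset.sum_range_succ, hmt, hmt', mul_add, ← sub_sub, ← div_eq_mul_inv]
    rw [hmt] at ih
    -- The survival factor `(m + 1 - |T|) / (m + 1)` is a ratio of consecutive binomial
    -- coefficients, so the product telescopes.
    have hchoose : (m.choose T.card : ℝ) * (m + 1 : ℕ) =
        ((m + 1).choose T.card) * ((m + 1 : ℕ) - T.card) := by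
      have := Nat.choose_mul_succ_eq m T.card
      rw [← Nat.cast_sub (by omega)]
      exact_mod_cast this
    have hpos : (0 : ℝ) < (m + 1 : ℕ) := by positivity
    have hnn : (0 : ℝ) ≤ (m + 1 : ℕ) - T.card := by
      rw [sub_nonneg]; exact_mod_cast (by omega : T.card ≤ m + 1)
    refine le_of_mul_le_mul_left ?_ hpos
    calc _ = (k.choose T.card : ℝ) * ((m + 1 : ℕ) * stageSum n q T (t + 1)
          (c - T.card * ∑ s ∈ Finset.range t, ((k - s : ℕ) : ℝ)⁻¹ - T.card / (m + 1 : ℕ))) := by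
          ring
      _ ≤ (k.choose T.card : ℝ) * (((m + 1 : ℕ) - T.card) * stageSum n q T t
          (c - T.card * ∑ s ∈ Finset.range t, ((k - s : ℕ) : ℝ)⁻¹)) := by gcongr
      _ = ((m + 1 : ℕ) - T.card) * ((k.choose T.card : ℝ) * stageSum n q T t
          (c - T.card * ∑ s ∈ Finset.range t, ((k - s : ℕ) : ℝ)⁻¹)) := by ring
      _ ≤ ((m + 1 : ℕ) - T.card) * ((m + 1).choose T.card * stageSum n q T 0 c) := by gcongr
      _ = _ := by rw [← mul_assoc, mul_comm _ (((m + 1).choose T.card : ℕ) : ℝ), ← hchoose]; ring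

/-- At this time only `U = T` survives, so the count on `T` is the decoder's actual ripple. -/
theorem stageSum_last (q : Finset (Fin k) → ℝ) (T : Finset (Fin k)) (c : ℝ) :
    stageSum n q T (k - T.card) c = ∑ N : Fin n → Finset (Fin k),
      (∏ j, q (N j)) * (decode N (k - T.card) T).toReal * (((ripple N T).card : ℝ) - c) ^ 2 := by
  have hT : T.card ≤ k := by simpa using Finset.card_le_univ T
  have hfil : Finset.univ.filter (fun U : Finset (Fin k) => T ⊆ U ∧ U.card + (k - T.card) = k) =
      {T} := by
    ext U
    simp only [Finset.mem_filter, Finset.mem_univ, true_and, Finset.mem_singleton]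
    constructor
    · rintro ⟨h1, h2⟩
      exact (Finset.eq_of_subset_of_card_le h1 (by omega)).symm
    · rintro rfl
      exact ⟨subset_rfl, by omega⟩
  rw [stageSum, hfil, Finset.sum_singleton]

/-- The second moment bound for the ripple at the stage with `m` unrecovered symbols. -/
theorem sum_ripple_sq_le {q : Finset (Fin k) → ℝ} (hq : ∀ S, 0 ≤ q S)
    (hqc : ∀ S S' : Finset (Fin k), S.card = S'.card → q S = q S') (hq1 : ∑ S, q S = 1)
    (n m : ℕ) (hm : m ≤ k) (h : ℝ) (hh : ∀ T : Finset (Fin k), T.card = m →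
      ∑ S, q S * (if (S ∩ T).card = 1 then 1 else 0) = h) :
    ∑ T ∈ Finset.univ.powersetCard m, ∑ N : Fin n → Finset (Fin k),
      (∏ j, q (N j)) * (decode N (k - m) T).toReal * (((ripple N T).card : ℝ) -
        (n * h - m * ∑ s ∈ Finset.range (k - m), ((k - s : ℕ) : ℝ)⁻¹)) ^ 2 ≤ n := by
  have hpos : (0 : ℝ) < k.choose m := by exact_mod_cast Nat.choose_pos hm
  have key : ∀ T ∈ (Finset.univ : Finset (Fin k)).powersetCard m,
      ∑ N : Fin n → Finset (Fin k),
        (∏ j, q (N j)) * (decode N (k - m) T).toReal * (((ripple N T).card : ℝ) -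
          (n * h - m * ∑ s ∈ Finset.range (k - m), ((k - s : ℕ) : ℝ)⁻¹)) ^ 2 ≤
        n / k.choose m := by
    intro T hT
    obtain rfl := (Finset.mem_powersetCard.mp hT).2
    rw [← stageSum_last, le_div_iff₀' hpos]
    refine (choose_mul_stageSum_le hq hqc T _ _ (by omega)).trans ?_
    rw [Nat.sub_sub_self hm, Nat.choose_self, Nat.cast_one, one_mul, ← hh T rfl]
    exact stageSum_zero_le hq hq1 T n
  refine (Finset.sum_le_sum key).trans_eq ?_
  rw [Finset.sum_const, Finset.card_powersetCard, Finset.card_univ, Fintype.card_fin,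
    nsmul_eq_mul, mul_div_cancel₀ _ hpos.ne']

/-! ### The LT symbol law and the conditional mean of the ripple -/

/-- Dependence on `S` through its size alone is what the exchangeability argument asks of `q`. -/
theorem symbolLaw_toReal {D : PMF ℕ} (hD : D.support ⊆ Set.Icc 1 k) (S : Finset (Fin k)) :
    (symbolLaw D k S).toReal = (D S.card).toReal / k.choose S.card := by
  have hSk : S.card ≤ k := by simpa using Finset.card_le_univ S
  have hterm : ∀ d, d ≠ S.card → D d * (if h : ((Finset.univ : Finset (Fin k)).powersetCard
      d).Nonempty then PMF.uniformOfFinset _ h else PMF.pure ∅ : PMF (Finset (Fin k))) S = 0 := by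
    intro d hd
    by_cases hdk : d ∈ D.support
    · have hle := (hD hdk).2
      have hne : ((Finset.univ : Finset (Fin k)).powersetCard d).Nonempty :=
        Finset.powersetCard_nonempty.mpr (by simpa using hle)
      rw [dif_pos hne, PMF.uniformOfFinset_apply_of_notMem, mul_zero]
      simp [Finset.mem_powersetCard, hd.symm]
    · rw [PMF.mem_support_iff, not_not] at hdk
      rw [hdk, zero_mul]
  have hne : ((Finset.univ : Finset (Fin k)).powersetCard S.card).Nonempty :=
    ⟨S, by simp [Finset.mem_powersetCard]⟩
  rw [symbolLaw, PMF.bind_apply, tsum_eq_single S.card hterm, dif_pos hne,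
    PMF.uniformOfFinset_apply_of_mem _ (by simp [Finset.mem_powersetCard]), ENNReal.toReal_mul]
  simp [div_eq_mul_inv]

theorem iidLaw_toReal {α : Type} [Fintype α] (q : PMF α) (N : Fin n → α) :
    (iidLaw q n N).toReal = ∏ j, (q (N j)).toReal := by
  simp [iidLaw, ENNReal.toReal_prod]

theorem decodeLaw_toReal (D : PMF ℕ) (k n t : ℕ) (N : Fin n → Finset (Fin k))
    (U : Finset (Fin k)) :
    (decodeLaw D k n t (N, U)).toReal =
      (∏ j, (symbolLaw D k (N j)).toReal) * (decode N t U).toReal := by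
  rw [decodeLaw, PMF.bind_apply, tsum_eq_single N, ENNReal.toReal_mul, iidLaw_toReal,
    PMF.map_apply, tsum_eq_single U]
  · simp
  · intro V hV
    simp [hV.symm]
  · intro N' hN'
    rw [PMF.map_apply, ENNReal.tsum_eq_zero.mpr, mul_zero]
    intro V
    simp [hN'.symm]

/-- Such a set is a point of `T` together with `d` points outside `T`. -/
theorem card_filter_card_inter_eq_one (T : Finset (Fin k)) (d : ℕ) :
    (((Finset.univ : Finset (Fin k)).powersetCard (d + 1)).filter
      fun S => (S ∩ T).card = 1).card = T.card * (k - T.card).choose d := by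
  have h : T.card * (k - T.card).choose d = (T ×ˢ (Tᶜ).powersetCard d).card := by
    rw [Finset.card_product, Finset.card_powersetCard, Finset.card_compl, Fintype.card_fin]
  rw [h]
  symm
  refine Finset.card_bij (fun p _ => insert p.1 p.2) ?_ ?_ ?_
  · rintro ⟨x, S⟩ hp
    simp only [Finset.mem_product, Finset.mem_powersetCard, Finset.mem_filter] at hp ⊢
    obtain ⟨hx, hS, hd⟩ := hp
    have hST : S ∩ T = ∅ := Finset.disjoint_iff_inter_eq_empty.mp
      (Finset.disjoint_left.mpr fun z hz => Finset.mem_compl.mp (hS hz))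
    have hxS : x ∉ S := fun h => Finset.mem_compl.mp (hS h) hx
    refine ⟨⟨Finset.subset_univ _, by rw [Finset.card_insert_of_notMem hxS, hd]⟩, ?_⟩
    rw [Finset.insert_inter_of_mem hx, hST]
    simp
  · rintro ⟨x, S⟩ hp ⟨y, S'⟩ hp' heq
    simp only [Finset.mem_product, Finset.mem_powersetCard] at hp hp' heq
    have hST : ∀ z ∈ S, z ∉ T := fun z hz => Finset.mem_compl.mp (hp.2.1 hz)
    have hST' : ∀ z ∈ S', z ∉ T := fun z hz => Finset.mem_compl.mp (hp'.2.1 hz)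
    have hxy : x = y := by
      have : x ∈ insert y S' := heq ▸ Finset.mem_insert_self x S
      rcases Finset.mem_insert.mp this with h | h
      · exact h
      · exact absurd hp.1 (hST' x h)
    subst hxy
    have hxS : x ∉ S := fun h => hST x h hp.1
    have hxS' : x ∉ S' := fun h => hST' x h hp.1
    rw [← Finset.erase_insert hxS, heq, Finset.erase_insert hxS']
  · intro S hS
    simp only [Finset.mem_powersetCard, Finset.mem_filter] at hS
    obtain ⟨⟨_, hd⟩, h1⟩ := hS
    obtain ⟨x, hx⟩ := Finset.card_eq_one.mp h1
    have hxm : x ∈ S ∩ T := by simp [hx]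
    rw [Finset.mem_inter] at hxm
    refine ⟨(x, S.erase x), ?_, Finset.insert_erase hxm.1⟩
    simp only [Finset.mem_product, Finset.mem_powersetCard]
    refine ⟨hxm.2, fun z hz => ?_, by rw [Finset.card_erase_of_mem hxm.1, hd]; rfl⟩
    rw [Finset.mem_erase] at hz
    rw [Finset.mem_compl]
    intro hzT
    have : z ∈ S ∩ T := Finset.mem_inter.mpr ⟨hz.2, hzT⟩
    rw [hx, Finset.mem_singleton] at this
    exact hz.1 this

/-- The probability that an output symbol has exactly one neighbour in a given set of `m`
information symbols. -/
noncomputable def hitProb (D : PMF ℕ) (k m : ℕ) : ℝ :=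
  ∑ d ∈ Finset.range k,
    (D (d + 1)).toReal * ((m * (k - m).choose d : ℕ) / (k.choose (d + 1) : ℝ))

theorem sum_symbolLaw_eq_hitProb {D : PMF ℕ} (hD : D.support ⊆ Set.Icc 1 k)
    (T : Finset (Fin k)) :
    ∑ S, (symbolLaw D k S).toReal * (if (S ∩ T).card = 1 then 1 else 0) =
      hitProb D k T.card := by
  rw [← Finset.powerset_univ, Finset.sum_powerset, Finset.card_univ, Fintype.card_fin,
    Finset.sum_range_succ', Finset.powersetCard_zero, Finset.sum_singleton, Finset.empty_inter,
    Finset.card_empty, if_neg zero_ne_one, mul_zero, add_zero, hitProb]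
  refine Finset.sum_congr rfl fun d _ => ?_
  rw [← card_filter_card_inter_eq_one, Finset.card_filter, Nat.cast_sum, Finset.sum_div,
    Finset.mul_sum]
  refine Finset.sum_congr rfl fun S hS => ?_
  rw [symbolLaw_toReal hD, (Finset.mem_powersetCard.mp hS).2]
  push_cast
  ring

theorem sum_symbolLaw_toReal (D : PMF ℕ) (k : ℕ) :
    ∑ S, (symbolLaw D k S).toReal = 1 := by
  rw [← ENNReal.toReal_sum (fun _ _ => PMF.apply_ne_top _ _),
    ← tsum_fintype (L := .unconditional _), PMF.tsum_coe, ENNReal.toReal_one]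

/-- The predicted size of the ripple when `m` of `k` symbols are unrecovered. -/
noncomputable def predictedRipple (D : PMF ℕ) (k n m : ℕ) : ℝ :=
  n * hitProb D k m - m * ∑ s ∈ Finset.range (k - m), ((k - s : ℕ) : ℝ)⁻¹

theorem sum_decodeLaw_sq_le {D : PMF ℕ} (hD : D.support ⊆ Set.Icc 1 k) (n m : ℕ) (hm : m ≤ k) :
    ∑ s : (Fin n → Finset (Fin k)) × Finset (Fin k),
      (if s.2.card = m then (decodeLaw D k n (k - m) s).toReal else 0) *
        (((ripple s.1 s.2).card : ℝ) - predictedRipple D k n m) ^ 2 ≤ n := by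
  refine le_of_eq_of_le ?_ (sum_ripple_sq_le (q := fun S => (symbolLaw D k S).toReal)
    (fun _ => ENNReal.toReal_nonneg) ?_ (sum_symbolLaw_toReal D k) n m hm (hitProb D k m) ?_)
  · rw [Fintype.sum_prod_type_right, ← Finset.univ_filter_card_eq, Finset.sum_filter]
    refine Finset.sum_congr rfl fun T _ => ?_
    split_ifs with hT
    · simp only [decodeLaw_toReal, predictedRipple]
    · simp
  · intro S S' h
    simp only [symbolLaw_toReal hD, h]
  · rintro T rfl
    exact sum_symbolLaw_eq_hitProb hD T

theorem reachProb_nonneg (D : PMF ℕ) (k n m : ℕ) : 0 ≤ reachProb D k n m :=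
  Finset.sum_nonneg fun s _ => by split_ifs <;> simp

/-- Given that the stage is reached with probability `ρ`, the conditional expectation of the ripple
is within `√(n / ρ)` of its predicted size. -/
theorem sq_expectedRipple_sub_le {D : PMF ℕ} (hD : D.support ⊆ Set.Icc 1 k) (n m : ℕ)
    (hm : m ≤ k) (hr : 0 < reachProb D k n m) :
    (expectedRipple D k n m - predictedRipple D k n m) ^ 2 ≤ n / reachProb D k n m := by
  set c := predictedRipple D k n m
  set a : (Fin n → Finset (Fin k)) × Finset (Fin k) → ℝ := fun s =>
    if s.2.card = m then (decodeLaw D k n (k - m) s).toReal else 0 with ha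
  have ha0 : ∀ s, 0 ≤ a s := fun s => by simp only [a]; split_ifs <;> simp
  have hsum : ∑ s, a s = reachProb D k n m := rfl
  have hE : expectedRipple D k n m - c =
      (∑ s, a s * (((ripple s.1 s.2).card : ℝ) - c)) / reachProb D k n m := by
    simp only [mul_sub, Finset.sum_sub_distrib, ← Finset.sum_mul, hsum]
    rw [sub_div, mul_div_cancel_left₀ _ hr.ne', expectedRipple]
    congr 2
    refine Finset.sum_congr rfl fun s _ => ?_
    simp only [a]
    split_ifs <;> simp
  -- Cauchy–Schwarz on the event of reaching the stage, whose total mass is `reachProb`.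
  have hCS : (∑ s, a s * (((ripple s.1 s.2).card : ℝ) - c)) ^ 2 ≤
      (∑ s, a s) * ∑ s, a s * (((ripple s.1 s.2).card : ℝ) - c) ^ 2 :=
    Finset.sum_sq_le_sum_mul_sum_of_sq_le_mul _ (fun s _ => ha0 s)
      (fun s _ => mul_nonneg (ha0 s) (sq_nonneg _)) fun s _ => le_of_eq (by ring)
  have hV := sum_decodeLaw_sq_le hD n m hm
  rw [hE, div_pow, div_le_div_iff₀ (by positivity) hr, hsum] at *
  calc _ ≤ (reachProb D k n m * n) * reachProb D k n m := by
        refine mul_le_mul_of_nonneg_right (hCS.trans ?_) hr.le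
        exact mul_le_mul_of_nonneg_left hV hr.le
    _ = _ := by ring

theorem expectedRipple_nonneg (D : PMF ℕ) (k n m : ℕ) : 0 ≤ expectedRipple D k n m :=
  div_nonneg (Finset.sum_nonneg fun s _ => by split_ifs <;> positivity)
    (reachProb_nonneg D k n m)

theorem expectedRipple_le (D : PMF ℕ) (k n m : ℕ) : expectedRipple D k n m ≤ n := by
  refine div_le_of_le_mul₀ (reachProb_nonneg D k n m) (Nat.cast_nonneg n) ?_
  rw [reachProb, Finset.mul_sum]
  refine Finset.sum_le_sum fun s _ => ?_
  split_ifs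
  · rw [mul_comm]
    refine mul_le_mul_of_nonneg_right ?_ ENNReal.toReal_nonneg
    exact_mod_cast (by simpa using Finset.card_le_univ (ripple s.1 s.2))
  · simp

/-! ### Asymptotics of the predicted ripple -/

theorem tendsto_floor_mul_div (w : ℝ) (hw : 0 ≤ w) :
    Tendsto (fun k : ℕ => (⌊w * k⌋₊ : ℝ) / k) atTop (𝓝 w) :=
  (tendsto_nat_floor_mul_div_atTop hw).comp tendsto_natCast_atTop_atTop

theorem tendsto_sub_div {a : ℕ → ℕ} {α : ℝ}
    (ha : Tendsto (fun k : ℕ => (a k : ℝ) / k) atTop (𝓝 α)) (j : ℕ) :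
    Tendsto (fun k : ℕ => ((a k - j : ℕ) : ℝ) / k) atTop (𝓝 α) := by
  have h1 : Tendsto (fun k : ℕ => (a k : ℝ) / k - (j : ℝ) / k) atTop (𝓝 α) := by
    simpa using ha.sub (tendsto_const_div_atTop_nhds_zero_nat (j : ℝ))
  refine tendsto_of_tendsto_of_tendsto_of_le_of_le h1 ha (fun k => ?_) fun k => ?_
  · dsimp only
    rw [← sub_div]
    refine div_le_div_of_nonneg_right ?_ (Nat.cast_nonneg k)
    rw [sub_le_iff_le_add]
    exact_mod_cast Nat.sub_le_iff_le_add.mp (le_refl (a k - j))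
  · dsimp only
    gcongr
    exact Nat.sub_le _ _

theorem tendsto_sub_floor_div {u : ℝ} (hu0 : 0 < u) (hu1 : u ≤ 1) :
    Tendsto (fun k : ℕ => ((k - ⌊u * k⌋₊ : ℕ) : ℝ) / k) atTop (𝓝 (1 - u)) := by
  refine ((tendsto_const_nhds (x := (1 : ℝ))).sub (tendsto_floor_mul_div u hu0.le)).congr' ?_
  filter_upwards [eventually_gt_atTop 0] with k hk
  have hle : ⌊u * k⌋₊ ≤ k := Nat.floor_le_of_le (mul_le_of_le_one_left (Nat.cast_nonneg k) hu1)
  have : (k : ℝ) ≠ 0 := by positivity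
  rw [Nat.cast_sub hle, sub_div, div_self this]

theorem choose_div_choose_eq_prod (a b d : ℕ) :
    (a.choose d : ℝ) / b.choose d =
      ∏ i ∈ Finset.range d, ((a - i : ℕ) : ℝ) / ((b - i : ℕ) : ℝ) := by
  have h (c : ℕ) : (∏ i ∈ Finset.range d, ((c - i : ℕ) : ℝ)) = d.factorial * c.choose d := by
    exact_mod_cast (Nat.descFactorial_eq_prod_range c d).symm.trans
      (Nat.descFactorial_eq_factorial_mul_choose c d)
  rw [Finset.prod_div_distrib, h, h, mul_div_mul_left _ _ (by positivity)]

theorem choose_div_choose_le_pow {a b : ℕ} (hab : a ≤ b) (d : ℕ) :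
    (a.choose d : ℝ) / b.choose d ≤ ((a : ℝ) / b) ^ d := by
  rw [choose_div_choose_eq_prod]
  refine (Finset.prod_le_prod (g := fun _ => (a : ℝ) / b) (fun i _ => by positivity)
    fun i _ => ?_).trans_eq (by rw [Finset.prod_const, Finset.card_range])
  rcases Nat.eq_zero_or_pos (a - i) with h | h
  · rw [h]; simp; positivity
  have hb : 0 < b - i := by omega
  have hb' : 0 < b := by omega
  rw [div_le_div_iff₀ (by exact_mod_cast hb) (by exact_mod_cast hb'), Nat.cast_sub (by omega),
    Nat.cast_sub (by omega)]
  have : (i : ℝ) * a ≤ i * b := by gcongr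
  linarith

/-- In this form the limit `(d + 1) u (1 - u) ^ d`, a term of `u P'(1 - u)`, is visible factor by
factor. -/
theorem hit_ratio_eq (k m d : ℕ) (hk : 0 < k) :
    ((m * (k - m).choose d : ℕ) : ℝ) / k.choose (d + 1) =
      (d + 1) * (m / k) * ((k - m).choose d / (k - 1).choose d) := by
  obtain ⟨l, rfl⟩ : ∃ l, k = l + 1 := ⟨k - 1, by omega⟩
  have h : ((l + 1 : ℕ) : ℝ) * l.choose d = (l + 1).choose (d + 1) * (d + 1 : ℕ) := by
    exact_mod_cast Nat.add_one_mul_choose_eq l d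
  have h1 : ((l + 1).choose (d + 1) : ℝ) = (l + 1 : ℕ) * l.choose d / (d + 1 : ℕ) := by
    rw [h]; field_simp
  rw [h1, Nat.add_sub_cancel]
  push_cast
  by_cases h0 : (l.choose d : ℝ) = 0
  · simp [h0]
  · field_simp

theorem summable_succ_mul_pow {r : ℝ} (h0 : 0 ≤ r) (h1 : r < 1) :
    Summable fun d : ℕ => ((d : ℝ) + 1) * r ^ d := by
  have hr : ‖r‖ < 1 := by rwa [Real.norm_of_nonneg h0]
  have h := (summable_pow_mul_geometric_of_norm_lt_one 1 hr).add
    (summable_geometric_of_norm_lt_one hr)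
  refine h.congr fun d => ?_
  ring

/-- Termwise differentiation inside a disc of radius `r < 1`. Bounded coefficients suffice, so mass
of the degree distributions may escape to infinity in the limit. -/
theorem deriv_genFun {p : ℕ → ℝ} (hp0 : ∀ i, 0 ≤ p i) (hp1 : ∀ i, p i ≤ 1) {x : ℝ} (hx0 : 0 ≤ x)
    (hx1 : x < 1) :
    deriv (genFun p) x = ∑' d : ℕ, p (d + 1) * ((d + 1) * x ^ d) := by
  obtain ⟨r, hxr, hr1⟩ := exists_between hx1
  have hr0 : 0 < r := hx0.trans_lt hxr
  have hsum : Summable fun d : ℕ => (d : ℝ) * r ^ (d - 1) := by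
    rw [← summable_nat_add_iff 1]
    simpa using summable_succ_mul_pow hr0.le hr1
  have hle : ∀ (i : ℕ) (y : ℝ), |y| ≤ r → ‖p i * (i * y ^ (i - 1))‖ ≤ i * r ^ (i - 1) := by
    intro i y hy
    rw [norm_mul, norm_mul, norm_pow, Real.norm_of_nonneg (hp0 i), Real.norm_natCast,
      Real.norm_eq_abs]
    refine (mul_le_of_le_one_left (by positivity) (hp1 i)).trans ?_
    gcongr
  have hd : HasDerivAt (fun z => ∑' i, p i * z ^ i) (∑' i : ℕ, p i * (i * x ^ (i - 1))) x := by
    refine hasDerivAt_tsum_of_isPreconnected (t := Metric.ball (0 : ℝ) r) (y₀ := 0) hsum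
      Metric.isOpen_ball (convex_ball (0 : ℝ) r).isPreconnected
      (fun i y _ => (hasDerivAt_pow i y).const_mul (p i)) (fun i y hy => hle i y ?_)
      (Metric.mem_ball_self hr0) ?_ ?_
    · simpa using (mem_ball_zero_iff.mp hy).le
    · refine summable_of_ne_finset_zero (s := {0}) fun i hi => ?_
      simp only [Finset.mem_singleton] at hi
      simp [hi]
    · simpa [abs_of_nonneg hx0] using hxr
  have hs : Summable fun i : ℕ => p i * (i * x ^ (i - 1)) :=
    Summable.of_norm_bounded hsum fun i => hle i x (by rw [abs_of_nonneg hx0]; exact hxr.le)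
  have h1 : deriv (genFun p) x = ∑' i : ℕ, p i * (i * x ^ (i - 1)) := hd.deriv
  rw [h1, hs.tsum_eq_zero_add]
  simp

theorem hitProb_eq_tsum (D : PMF ℕ) (k m : ℕ) :
    hitProb D k m = ∑' d : ℕ,
      (D (d + 1)).toReal * ((m * (k - m).choose d : ℕ) / (k.choose (d + 1) : ℝ)) := by
  rw [tsum_eq_sum (s := Finset.range k)]
  · rfl
  · intro d hd
    rw [Finset.mem_range, not_lt] at hd
    rw [Nat.choose_eq_zero_of_lt (show k < d + 1 by omega)]
    simp

theorem toReal_le_one (D : PMF ℕ) (i : ℕ) : (D i).toReal ≤ 1 :=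
  ENNReal.toReal_le_of_le_ofReal zero_le_one (by simpa using D.coe_le_one i)

theorem tendsto_hitProb {D : ℕ → PMF ℕ} {p : ℕ → ℝ}
    (hp : ∀ i, Tendsto (fun k => (D k i).toReal) atTop (𝓝 (p i))) {u : ℝ} (hu0 : 0 < u)
    (hu1 : u ≤ 1) :
    Tendsto (fun k : ℕ => hitProb (D k) k ⌊u * k⌋₊) atTop
      (𝓝 (u * deriv (genFun p) (1 - u))) := by
  have hp0 : ∀ i, 0 ≤ p i := fun i => ge_of_tendsto' (hp i) fun k => ENNReal.toReal_nonneg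
  have hp1 : ∀ i, p i ≤ 1 := fun i => le_of_tendsto' (hp i) fun k => toReal_le_one _ _
  rw [deriv_genFun hp0 hp1 (sub_nonneg.mpr hu1) (by linarith), ← tsum_mul_left]
  simp only [hitProb_eq_tsum]
  have hfrac (i j : ℕ) : Tendsto (fun k : ℕ => ((k - ⌊u * k⌋₊ - i : ℕ) : ℝ) / ((k - j : ℕ) : ℝ))
      atTop (𝓝 (1 - u)) := by
    have h1 : Tendsto (fun k : ℕ => (k : ℝ) / k) atTop (𝓝 1) := by
      refine tendsto_const_nhds.congr' ?_
      filter_upwards [eventually_gt_atTop 0] with k hk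
      rw [div_self (by positivity)]
    have h := (tendsto_sub_div (tendsto_sub_floor_div hu0 hu1) i).div (tendsto_sub_div h1 j)
      one_ne_zero
    rw [div_one] at h
    refine h.congr' ?_
    filter_upwards [eventually_gt_atTop 0] with k hk
    exact div_div_div_cancel_right₀ (by positivity) _ _
  have hm := tendsto_floor_mul_div u hu0.le
  -- The ratio `(k - m) / (k - 1)` tends to `1 - u`, so it is eventually below `1 - u / 2`; this
  -- gives a summable bound uniform in `k`.
  refine tendsto_tsum_of_dominated_convergence
    (bound := fun d : ℕ => ((d : ℝ) + 1) * (1 - u / 2) ^ d)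
    (summable_succ_mul_pow (by linarith) (by linarith)) (fun d => ?_) ?_
  · have hprod : Tendsto (fun k : ℕ => ((k - ⌊u * k⌋₊).choose d : ℝ) / (k - 1).choose d) atTop
        (𝓝 ((1 - u) ^ d)) := by
      simp only [choose_div_choose_eq_prod]
      have := tendsto_finsetProd (Finset.range d) fun i _ => hfrac i (1 + i)
      simpa [Nat.sub_sub] using this
    have h := (hp (d + 1)).mul ((hm.const_mul ((d : ℝ) + 1)).mul hprod)
    refine (h.congr' ?_).trans_eq ?_
    · filter_upwards [eventually_gt_atTop 0] with k hk
      rw [hit_ratio_eq k _ d hk]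
    · congr 1; ring
  · have hlt := (hfrac 0 1).eventually (gt_mem_nhds (show 1 - u < 1 - u / 2 by linarith))
    have hpos := hm.eventually (lt_mem_nhds hu0)
    filter_upwards [hlt, hpos, eventually_gt_atTop 0] with k hk1 hk2 hk d
    have hk' : (0 : ℝ) < k := by exact_mod_cast hk
    -- Needed for `k - m ≤ k - 1` in the comparison of binomial coefficients.
    have hmpos : 0 < ⌊u * k⌋₊ := by
      by_contra h0
      rw [Nat.eq_zero_of_not_pos h0] at hk2
      simp at hk2
    have hle : (⌊u * k⌋₊ : ℝ) / k ≤ 1 := by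
      rw [div_le_one hk']
      exact (Nat.floor_le (by positivity)).trans (mul_le_of_le_one_left hk'.le hu1)
    rw [hit_ratio_eq k _ d hk, Real.norm_of_nonneg (by positivity)]
    refine (mul_le_of_le_one_left (by positivity) (toReal_le_one _ _)).trans ?_
    refine mul_le_mul (mul_le_of_le_one_right (by positivity) hle) ?_ (by positivity)
      (by positivity)
    refine (choose_div_choose_le_pow (by omega) d).trans ?_
    exact pow_le_pow_left₀ (by positivity) hk1.le d

theorem sum_inv_eq_harmonic_sub {k m : ℕ} (hm : m ≤ k) :
    ∑ s ∈ Finset.range (k - m), ((k - s : ℕ) : ℝ)⁻¹ = (harmonic k : ℝ) - harmonic m := by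
  obtain ⟨j, rfl⟩ := Nat.exists_eq_add_of_le hm
  rw [Nat.add_sub_cancel_left]
  induction j with
  | zero => simp
  | succ j ih =>
    rw [Finset.sum_range_succ', ← Nat.add_assoc, harmonic_succ]
    have : ∀ s, m + j + 1 - (s + 1) = m + j - s := by omega
    simp only [this, ih (Nat.le_add_right m j)]
    push_cast
    ring

theorem tendsto_predictedRipple_div {D : ℕ → PMF ℕ} {p : ℕ → ℝ}
    (hp : ∀ i, Tendsto (fun k => (D k i).toReal) atTop (𝓝 (p i))) {u : ℝ} (hu0 : 0 < u)
    (hu1 : u ≤ 1) {w : ℝ} (hw : 0 ≤ w) :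
    Tendsto (fun k : ℕ => predictedRipple (D k) k ⌊w * k⌋₊ ⌊u * k⌋₊ / k) atTop
      (𝓝 (u * (w * deriv (genFun p) (1 - u) + Real.log u))) := by
  have hm := tendsto_floor_mul_div u hu0.le
  have hmtop : Tendsto (fun k : ℕ => ⌊u * k⌋₊) atTop atTop :=
    tendsto_nat_floor_atTop.comp (tendsto_natCast_atTop_atTop.const_mul_atTop hu0)
  have hH := Real.tendsto_harmonic_sub_log
  have hlog := (Real.continuousAt_log hu0.ne').tendsto.comp hm
  have hsum : Tendsto (fun k : ℕ => ∑ s ∈ Finset.range (k - ⌊u * k⌋₊), ((k - s : ℕ) : ℝ)⁻¹) atTop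
      (𝓝 (-Real.log u)) := by
    -- Euler's constant cancels between `H_k - log k` and `H_m - log m`, leaving `-log (m / k)`.
    have h := (hH.sub (hH.comp hmtop)).sub hlog
    rw [sub_self, zero_sub] at h
    refine h.congr' ?_
    filter_upwards [eventually_gt_atTop 0, hmtop.eventually_gt_atTop 0] with k hk hk'
    have hle : ⌊u * k⌋₊ ≤ k :=
      Nat.floor_le_of_le (mul_le_of_le_one_left (Nat.cast_nonneg k) hu1)
    rw [sum_inv_eq_harmonic_sub hle]
    simp only [Function.comp_apply]
    rw [Real.log_div (by positivity) (by positivity)]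
    ring
  have h := ((tendsto_floor_mul_div w hw).mul (tendsto_hitProb hp hu0 hu1)).sub (hm.mul hsum)
  refine (h.congr fun k => ?_).trans_eq ?_
  · rw [predictedRipple]; ring
  · congr 1; ring

theorem tendsto_normalizedRipple {D : ℕ → PMF ℕ} (hD : ∀ k, 1 ≤ k → (D k).support ⊆ Set.Icc 1 k)
    {p : ℕ → ℝ} (hp : ∀ i, Tendsto (fun k => (D k i).toReal) atTop (𝓝 (p i))) {u : ℝ}
    (hu0 : 0 < u) (hu1 : u ≤ 1) {w : ℝ} (hw : 0 ≤ w) {c : ℝ} (hc : 0 < c)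
    (hreach : ∀ᶠ k : ℕ in atTop, c ≤ reachProb (D k) k ⌊w * k⌋₊ ⌊u * k⌋₊) :
    Tendsto (fun k => normalizedRipple (D k) k w u) atTop
      (𝓝 (u * (w * deriv (genFun p) (1 - u) + Real.log u))) := by
  have hpred := tendsto_predictedRipple_div hp hu0 hu1 hw
  -- The squared error is at most `n / c ≤ w k / c`; dividing by `k ^ 2` leaves `(w / c) / k`.
  have hzero : Tendsto (fun k : ℕ => √(w / c * (1 / (k : ℝ)))) atTop (𝓝 0) := by
    have h := (tendsto_one_div_atTop_nhds_zero_nat (𝕜 := ℝ)).const_mul (w / c)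
    rw [mul_zero] at h
    simpa using h.sqrt
  have hdiff : Tendsto (fun k : ℕ => normalizedRipple (D k) k w u -
      predictedRipple (D k) k ⌊w * k⌋₊ ⌊u * k⌋₊ / k) atTop (𝓝 0) := by
    refine squeeze_zero_norm' ?_ hzero
    filter_upwards [hreach, eventually_gt_atTop 0] with k hk hk0
    have hk' : (0 : ℝ) < k := by exact_mod_cast hk0
    have hle : ⌊u * k⌋₊ ≤ k :=
      Nat.floor_le_of_le (mul_le_of_le_one_left (Nat.cast_nonneg k) hu1)
    have h := sq_expectedRipple_sub_le (hD k hk0) ⌊w * k⌋₊ _ hle (hc.trans_le hk)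
    rw [normalizedRipple, ← sub_div, Real.norm_eq_abs]
    refine Real.abs_le_sqrt ?_
    rw [div_pow, div_le_iff₀ (by positivity)]
    refine h.trans ?_
    have hfl : (⌊w * k⌋₊ : ℝ) ≤ w * k := Nat.floor_le (by positivity)
    calc _ ≤ w * k / c := by gcongr
      _ = _ := by field_simp
  simpa using hdiff.add hpred

/-! ### Averaging over the random number of collected symbols -/

theorem normalizedRipple_nonneg (D : PMF ℕ) (k : ℕ) (w u : ℝ) : 0 ≤ normalizedRipple D k w u :=
  div_nonneg (expectedRipple_nonneg _ _ _ _) (Nat.cast_nonneg k)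

theorem normalizedRipple_le (D : PMF ℕ) (k : ℕ) {w : ℝ} (hw : 0 ≤ w) (u : ℝ) :
    normalizedRipple D k w u ≤ w :=
  div_le_of_le_mul₀ (Nat.cast_nonneg k) hw
    ((expectedRipple_le _ _ _ _).trans (Nat.floor_le (by positivity)))

theorem measurable_normalizedRipple (D : PMF ℕ) (k : ℕ) (u : ℝ) :
    Measurable fun w => normalizedRipple D k w u := by
  have h : Measurable fun w : ℝ => ⌊w * k⌋₊ := Nat.measurable_floor.comp (measurable_mul_const _)
  exact ((measurable_from_nat (f := fun n => expectedRipple D k n ⌊u * k⌋₊)).comp h).div_const _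

end LTCode

theorem corollary2
    -- the degree distribution for `k` information symbols, supported on `{1, …, k}`,
    -- and the coefficients of the limiting generating function
    (D : ℕ → PMF ℕ) (hD : ∀ k, 1 ≤ k → (D k).support ⊆ Set.Icc 1 k)
    (p : ℕ → ℝ) (hp : ∀ i, Tendsto (fun k => (D k i).toReal) atTop (𝓝 (p i)))
    -- the random normalized number of collected output symbols, with mean `w`
    {Ω : Type*} [MeasurableSpace Ω] (μ : Measure Ω) [IsProbabilityMeasure μ]
    (W : Ω → ℝ) (hW : Integrable W μ) (hW0 : ∀ᵐ a ∂μ, 0 ≤ W a)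
    (w : ℝ) (hw : ∫ a, W a ∂μ = w)
    -- the unrecovered fraction
    (u : ℝ) (hu0 : 0 < u) (hu1 : u ≤ 1)
    -- decoding gets as far as the unrecovered fraction `u` with nonvanishing probability
    (hreach : ∀ᵐ a ∂μ, ∃ c : ℝ, 0 < c ∧
      ∀ᶠ k : ℕ in atTop, c ≤ LTCode.reachProb (D k) k ⌊W a * k⌋₊ ⌊u * k⌋₊) :
    (∀ k, Integrable (fun a => LTCode.normalizedRipple (D k) k (W a) u) μ) ∧
    Tendsto (fun k => ∫ a, LTCode.normalizedRipple (D k) k (W a) u ∂μ) atTop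
      (𝓝 (u * (w * deriv (LTCode.genFun p) (1 - u) + Real.log u))) := by
  have hint : ∀ k, Integrable (fun a => LTCode.normalizedRipple (D k) k (W a) u) μ := by
    intro k
    refine hW.mono' ((LTCode.measurable_normalizedRipple (D k) k u).comp_aemeasurable
      hW.aemeasurable).aestronglyMeasurable ?_
    filter_upwards [hW0] with a ha
    rw [Real.norm_of_nonneg (LTCode.normalizedRipple_nonneg _ _ _ _)]
    exact LTCode.normalizedRipple_le _ _ ha _
  refine ⟨hint, ?_⟩
  -- The pointwise limit is affine in `W`, so only the mean of `W` enters.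
  have hlim : ∫ a, u * (W a * deriv (LTCode.genFun p) (1 - u) + Real.log u) ∂μ =
      u * (w * deriv (LTCode.genFun p) (1 - u) + Real.log u) := by
    rw [integral_const_mul, integral_add (hW.mul_const _) (integrable_const _),
      integral_mul_const, hw]
    simp
  rw [← hlim]
  -- `W` itself dominates for every `k`, including those where the stage has probability zero and
  -- the conditional mean is `0` by convention. The constant `c` may thus depend on the value of
  -- `W`.
  refine tendsto_integral_of_dominated_convergence W (fun k => (hint k).aestronglyMeasurable) hW
    (fun k => ?_) ?_
  · filter_upwards [hW0] with a ha
    rw [Real.norm_of_nonneg (LTCode.normalizedRipple_nonneg _ _ _ _)]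
    exact LTCode.normalizedRipple_le _ _ ha _
  · filter_upwards [hW0, hreach] with a ha hr
    obtain ⟨c, hc, hr⟩ := hr
    exact LTCode.tendsto_normalizedRipple hD hp hu0 hu1 ha hc hr
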